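/- **Conventions.** Let $G$ be a group and $H\le G$ a subgroup. A subset $A\subset G$ is *$H$-finite* if it is contained in finitely many cosets $Hg$. For a subset $A$ of a group, $A^{*}$ denotes its complement in that group. A subset $X\subset G$ is *$H$-almost invariant* if $HX=X$ and, for every $g\in G$, the symmetric difference of $X$ and $Xg$ is $H$-finite (equivalently, $H\backslash X$ is almost equal to its right translate by $g$ in $H\backslash G$); it is *nontrivial* if neither $X$ nor $X^{*}$ is $H$-finite. A corner (intersection) of an $H$-almost invariant set and an $S$-almost invariant set is *small* if it is $H$-finite or $S$-finite. A subset $Y$ of a finitely generated group $K$ is *adapted* to a family $\{S_i\}$ of subgroups of $K$ if there are a finite generating set of $K$, with associated Cayley graph $C(K)$, and an integer $D$ such that, for each $i$ and each $k\in K$, the coset $kS_i$ is contained in the $D$-neighbourhood in $C(K)$ of $Y$ or of $Y^{*}$. A graph of groups decomposition $\Gamma$ of $G$ is given by its universal covering (Bass–Serre) tree $T$: a simplicial tree on which $G$ acts without inversions, with $\Gamma=G\backslash T$ and with vertex and edge groups the stabilisers of vertices and edges of $T$. It is *minimal* if $T$ has no proper $G$-invariant subtree. For an oriented edge $s$ of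 $T$ let $Y_s$ be the set of vertices of that component of $T$ minus the interior of $s$ which contains the terminal vertex of $s$, and, for a base vertex $w$ of $T$, let $Z_s=\{g\in G: gw\in Y_s\}$, which is almost invariant over the stabiliser of $s$. A vertex $v$ of $T$ *encloses* an $H$-almost invariant set $X\subset G$ if, for every edge $s$ of $T$ incident to $v$ and oriented towards $v$, one of $Z_s^{*}\cap X^{*}$ and $Z_s^{*}\cap X$ is small (for any choice of base vertex $w$). A vertex $V$ of $\Gamma$ encloses $X$ if some vertex of $T$ above $V$ does. **Proposition.** Let $G$ be a finitely generated group with finitely generated subgroups $H\subset K$, and suppose that $G$ has a minimal graph of groups decomposition $\Gamma$ with a vertex $V$ whose associated group is $K$; let $v$ be a vertex of the universal covering tree $T$ which lies above $V$ and has stabiliser $K$. Let $E(V)$ denote the family of subgroups of $K$, each well defined up to conjugacy in $K$, associated to the edges of $\Gamma$ incident to $V$: for each such edge, oriented towards $V$ (a loop at $V$ counts twice), it contains the stabiliser of one edge of $T$ above it which is incident to $v$ and oriented towards $v$. Let $Y$ be a nontrivial $H$-almost invariant subset of $K$ which is adapted to the family $E(V)$. Then there is an $H$-almost invariant subset $X$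 of $G$ which is enclosed by $v$ (and hence by $V$) such that $X\cap K=Y$. -/

import Mathlib

open scoped Pointwise symmDiff

namespace AlmostInvariant

/-! ### Almost invariant sets -/

section Sets

variable {G : Type*} [Group G]

/-- A subset `A` of `G` is `H`-finite if its image in the coset space `H \ G` of all cosets `H g`
is finite, that is, if `A` is contained in finitely many cosets `H g`. -/
def HFinite (H : Subgroup G) (A : Set G) : Prop :=
  (Quotient.mk (QuotientGroup.rightRel H) '' A).Finite

/-- `X` is an `H`-almost invariant subset of `G`: it is invariant under left multiplication by `H`,
so it is the full preimage of a subset `H \ X` of `H \ G`, and for each `g` the subset `H \ X` is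
almost equal to its right translate by `g`. -/
structure IsAlmostInvariant (H : Subgroup G) (X : Set G) : Prop where
  left_invariant : ∀ h ∈ H, ∀ x ∈ X, h * x ∈ X
  almost_eq_translate : ∀ g : G, HFinite H (X ∆ ((fun x => x * g) '' X))

/-- `X` is nontrivial over `H`: the subset `H \ X` of `H \ G` is neither finite nor co-finite. -/
def IsNontrivial (H : Subgroup G) (X : Set G) : Prop :=
  ¬ HFinite H X ∧ ¬ HFinite H Xᶜ

/-- A corner `A` (an intersection) of an `H`-almost invariant set and an `S`-almost invariant set
is small if it is `H`-finite or `S`-finite. -/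
def IsSmall (H S : Subgroup G) (A : Set G) : Prop :=
  HFinite H A ∨ HFinite S A

/-- The group elements in the `D`-neighbourhood of `Y` in the Cayley graph of `G` with respect
to `A`. The edges of the Cayley graph join `g` to `g * a`, `a ∈ A`, so `G` acts on the left. -/
def cayleyNeighborhood (A : Set G) (D : ℕ) (Y : Set G) : Set G :=
  {g | ∃ y ∈ Y, (SimpleGraph.mulCayley A).edist g y ≤ (D : ℕ∞)}

/-- `Y` is adapted to the family `S` of subgroups of `G`: for some finite generating set of `G`
there is a single `D` such that each left coset `k S i` lies in the `D`-neighbourhood of `Y` or in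
the `D`-neighbourhood of the complement of `Y`. -/
def IsAdapted {ι : Type*} (S : ι → Subgroup G) (Y : Set G) : Prop :=
  ∃ A : Finset G, Subgroup.closure (A : Set G) = ⊤ ∧
    ∃ D : ℕ, ∀ (i : ι) (k : G),
      k • (S i : Set G) ⊆ cayleyNeighborhood (A : Set G) D Y ∨
      k • (S i : Set G) ⊆ cayleyNeighborhood (A : Set G) D Yᶜ

end Sets

/-! ### Graphs of groups and their universal covering trees -/

/-- A graph of groups decomposition `Γ` of `G`, presented by its universal covering (Bass-Serre)
tree: `G` acts on the set `T` of vertices of a simplicial tree by graph automorphisms and without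
inversions. The graph `Γ` is the quotient of the tree by `G`; its vertices and oriented edges are
`Γ.Vertex` and `Γ.Edge`. The group carried by a vertex or an edge of `Γ` is the stabiliser of a
vertex or an edge of the tree above it, and so is well defined up to conjugacy. -/
structure GraphOfGroupsDecomposition (G : Type*) [Group G] (T : Type*) [MulAction G T] where
  tree : SimpleGraph T
  isTree : tree.IsTree
  smul_adj : ∀ (g : G) {x y : T}, tree.Adj x y → tree.Adj (g • x) (g • y)
  no_inversion : ∀ (g : G) {x y : T}, tree.Adj x y → ¬ (g • x = y ∧ g • y = x)

namespace GraphOfGroupsDecomposition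

variable {G : Type*} [Group G] {T : Type*} [MulAction G T] (Γ : GraphOfGroupsDecomposition G T)

/-- The decomposition is minimal: the tree has no proper `G`-invariant subtree. -/
def IsMinimal : Prop :=
  ∀ S : Set T, (∀ (g : G), ∀ x ∈ S, g • x ∈ S) → (Γ.tree.induce S).Connected → S = Set.univ

/-- The action of `G` on the oriented edges of the tree. The oriented edge `s` runs from `s.fst` to
its terminal vertex `s.snd`. -/
instance : MulAction G Γ.tree.Dart where
  smul g s := ⟨(g • s.fst, g • s.snd), Γ.smul_adj g s.adj⟩
  one_smul s := SimpleGraph.Dart.ext _ _ (Prod.ext (one_smul G s.fst) (one_smul G s.snd))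
  mul_smul g h s :=
    SimpleGraph.Dart.ext _ _ (Prod.ext (mul_smul g h s.fst) (mul_smul g h s.snd))

/-- The vertices of the quotient graph `Γ`. -/
abbrev Vertex (_Γ : GraphOfGroupsDecomposition G T) : Type _ := MulAction.orbitRel.Quotient G T

/-- The vertex of `Γ` below a vertex of the tree. -/
def projVertex (v : T) : Γ.Vertex := Quotient.mk (MulAction.orbitRel G T) v

/-- The oriented edges of the quotient graph `Γ`. -/
abbrev Edge : Type _ := MulAction.orbitRel.Quotient G Γ.tree.Dart

/-- The oriented edge of `Γ` below an oriented edge of the tree. -/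
def projEdge (s : Γ.tree.Dart) : Γ.Edge := Quotient.mk (MulAction.orbitRel G Γ.tree.Dart) s

/-- The terminal vertex of an oriented edge of `Γ`. -/
def terminal : Γ.Edge → Γ.Vertex :=
  Quotient.lift (fun s : Γ.tree.Dart => Γ.projVertex s.snd) (by
    rintro a b ⟨g, rfl⟩
    exact Quotient.sound ⟨g, rfl⟩)

/-- The edges of `Γ` incident to the vertex `V`, oriented towards `V`. A loop at `V` gives two of
them, one for each end of the loop. -/
abbrev IncidentEdge (V : Γ.Vertex) : Type _ := {ε : Γ.Edge // Γ.terminal ε = V}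

/-- The stabiliser of an oriented edge of the tree. -/
def edgeGroup (s : Γ.tree.Dart) : Subgroup G := MulAction.stabilizer G s

/-- For a vertex `v` of the tree with stabiliser `K`, the map `c` chooses, for each edge `ε` of `Γ`
incident to the image of `v`, an edge of the tree above `ε` that is incident to `v` and oriented
towards `v`. Any two choices differ by translations by elements of `K`. -/
structure IsIncidentLift (v : T) (c : Γ.IncidentEdge (Γ.projVertex v) → Γ.tree.Dart) : Prop where
  projEdge_eq : ∀ ε, Γ.projEdge (c ε) = ε.1
  snd_eq : ∀ ε, (c ε).snd = v

/-- The family of subgroups of a vertex group `K` associated to the edges of `Γ` incident to that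
vertex, for a choice `c` of lifts. A different choice replaces each of them by a conjugate in `K`.
For lifts at a vertex with stabiliser `K` the edge groups are contained in `K`. -/
def incidentEdgeGroups (K : Subgroup G) {V : Γ.Vertex} (c : Γ.IncidentEdge V → Γ.tree.Dart) :
    Γ.IncidentEdge V → Subgroup K :=
  fun ε => (Γ.edgeGroup (c ε)).subgroupOf K

/-- The set `Y_s` of all vertices of that one of the two subtrees obtained by removing the interior
of the edge `s` which contains the terminal vertex of `s`. -/
def terminalSide (s : Γ.tree.Dart) : Set T :=
  {x | (Γ.tree.deleteEdges {s.edge}).Reachable s.snd x}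

/-- The set `Z_s = φ⁻¹(Y_s)`, where `φ g = g w` for a base vertex `w`. -/
def edgeSet (w : T) (s : Γ.tree.Dart) : Set G := {g | g • w ∈ Γ.terminalSide s}

/-- The vertex `v` of the tree encloses the `H`-almost invariant set `X`: for every edge `s` of the
tree incident to `v` and oriented towards `v`, one of the intersections of the complement of `Z_s`
with `X` and with the complement of `X` is small. This is required for every base vertex. -/
def Encloses (v : T) (H : Subgroup G) (X : Set G) : Prop :=
  ∀ (w : T) (s : Γ.tree.Dart), s.snd = v →
    IsSmall H (Γ.edgeGroup s) ((Γ.edgeSet w s)ᶜ ∩ Xᶜ) ∨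
    IsSmall H (Γ.edgeGroup s) ((Γ.edgeSet w s)ᶜ ∩ X)

end GraphOfGroupsDecomposition

end AlmostInvariant

/-!
Let `v` be the vertex with stabiliser `K`. Deleting `v` cuts the tree into branches, one for each
edge `s` oriented into `v`; the branch of `s` is the complement of `Γ.terminalSide s`. An element
`g` with `g • v = v` lies in `K`, and otherwise `g • v` lies in exactly one branch
(`exists_unique_branch`). The set `X` agrees with `Y` on `K`, and for every branch it contains
either all or none of the elements `g` that move `v` into it. Adaptedness decides which: the edges
into `v` in one `K`-orbit correspond to the left cosets of an edge group, and a branch is filled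
when the coset of its edge lies in `Y * B`, where `B` is a finite ball of `K`; otherwise its coset
lies in `Yᶜ * B`. This rule is invariant under `H` because `Y` is.

The main estimate is `hFinite_mul_mem_extension`: for every `g : G` the elements `k ∈ K` for which
`k * g ∈ X` and `k ∈ Y` disagree form an `H`-finite set. For `g ∈ K` this is almost invariance of
`Y`, and for `g ∉ K` it holds because `Y * B` is almost equal to `Y`. Now `x` and `x * g` can be
separated by `X` only if the translate by `x` of a fixed walk from `v` to `g • v` passes through
`v`. That puts `x` in one of finitely many cosets `K a`, on each of which the estimate applies
to `a` and to `a * g`; so `X` is almost invariant.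

Enclosing is immediate for the base vertex `v`. Changing the base vertex alters the set `Z_s` only
by elements carrying some edge of a fixed walk onto `s`, which fill finitely many cosets of the
stabiliser of `s` (`hFinite_separated`).
-/

namespace AlmostInvariant

/-! ### Sets contained in finitely many cosets -/

section HFinite

variable {G : Type*} [Group G] {H : Subgroup G} {A B : Set G}

theorem HFinite.mono (hB : HFinite H B) (h : A ⊆ B) : HFinite H A :=
  Set.Finite.subset hB (Set.image_mono h)

theorem HFinite.union (hA : HFinite H A) (hB : HFinite H B) : HFinite H (A ∪ B) := by
  unfold HFinite
  rw [Set.image_union]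
  exact Set.Finite.union hA hB

theorem hFinite_empty : HFinite H (∅ : Set G) := by
  simp [HFinite]

theorem HFinite.biUnion {ι : Type*} {s : Set ι} (hs : s.Finite) {f : ι → Set G}
    (h : ∀ i ∈ s, HFinite H (f i)) : HFinite H (⋃ i ∈ s, f i) := by
  unfold HFinite
  rw [Set.image_iUnion₂]
  exact hs.biUnion h

theorem hFinite_of_subset_coset (a : G) (h : ∀ x ∈ A, x * a⁻¹ ∈ H) : HFinite H A := by
  refine (Set.finite_singleton (Quotient.mk (QuotientGroup.rightRel H) a)).subset ?_
  rintro _ ⟨x, hx, rfl⟩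
  refine (Quotient.sound (s := QuotientGroup.rightRel H) ?_ : _ = _)
  exact (QuotientGroup.rightRel_apply (s := H)).2 (by simpa using H.inv_mem (h x hx))

theorem HFinite.image_mul_right (hA : HFinite H A) (a : G) :
    HFinite H ((fun x => x * a) '' A) := by
  -- Right translation by `a` descends to the coset space `H \ G`.
  let F : Quotient (QuotientGroup.rightRel H) → Quotient (QuotientGroup.rightRel H) :=
    Quotient.map (fun x => x * a) (by
      intro x y hxy
      refine (QuotientGroup.rightRel_apply (s := H)).2 ?_
      have := (QuotientGroup.rightRel_apply (s := H)).1 hxy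
      simpa [mul_assoc] using this)
  refine (Set.Finite.image F hA).subset ?_
  rintro _ ⟨_, ⟨x, hx, rfl⟩, rfl⟩
  exact ⟨_, ⟨x, hx, rfl⟩, rfl⟩

theorem HFinite.image_val {K : Subgroup G} {A : Set K} (hA : HFinite (H.subgroupOf K) A) :
    HFinite H (Subtype.val '' A) := by
  let F : Quotient (QuotientGroup.rightRel (H.subgroupOf K)) →
      Quotient (QuotientGroup.rightRel H) :=
    Quotient.map Subtype.val (by
      intro x y hxy
      refine (QuotientGroup.rightRel_apply (s := H)).2 ?_
      have := (QuotientGroup.rightRel_apply (s := H.subgroupOf K)).1 hxy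
      simpa [Subgroup.mem_subgroupOf] using this)
  refine (Set.Finite.image F hA).subset ?_
  rintro _ ⟨_, ⟨x, hx, rfl⟩, rfl⟩
  exact ⟨_, ⟨x, hx, rfl⟩, rfl⟩

theorem IsAlmostInvariant.hFinite_not_mul_mem_iff {X : Set G} (hX : IsAlmostInvariant H X)
    (g : G) : HFinite H {x | ¬ (x * g ∈ X ↔ x ∈ X)} := by
  refine (hX.almost_eq_translate g⁻¹).mono ?_
  intro x hx
  have : x ∈ (fun y => y * g⁻¹) '' X ↔ x * g ∈ X :=
    ⟨by rintro ⟨y, hy, rfl⟩; simpa using hy, fun h => ⟨_, h, by simp⟩⟩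
  simp only [Set.mem_ofPred_eq] at hx
  rw [Set.mem_symmDiff, this]
  tauto

theorem isAlmostInvariant_of_hFinite {X : Set G} (h₁ : ∀ h ∈ H, ∀ x ∈ X, h * x ∈ X)
    (h₂ : ∀ g : G, HFinite H {x | ¬ (x * g ∈ X ↔ x ∈ X)}) : IsAlmostInvariant H X := by
  refine ⟨h₁, fun g => (h₂ g⁻¹).mono ?_⟩
  intro x hx
  have : x ∈ (fun y => y * g) '' X ↔ x * g⁻¹ ∈ X :=
    ⟨by rintro ⟨y, hy, rfl⟩; simpa using hy, fun h => ⟨_, h, by simp⟩⟩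
  rw [Set.mem_symmDiff, this] at hx
  simp only [Set.mem_ofPred_eq]
  tauto

/-- Multiplying an almost invariant set, or its complement, on the right by a finite set changes
it only by an `H`-finite set; `a` allows for a further translation of the product. -/
theorem IsAlmostInvariant.hFinite_exists_mul {X : Set G} (hX : IsAlmostInvariant H X)
    {B : Set G} (hB : B.Finite) (a : G) :
    HFinite H {x | ∃ b ∈ B, ∃ y, x * a = y * b ∧ ¬ (y ∈ X ↔ x ∈ X)} := by
  refine (HFinite.biUnion hB fun b _ => hX.hFinite_not_mul_mem_iff (a * b⁻¹)).mono ?_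
  rintro x ⟨b, hb, y, hxy, h⟩
  simp only [Set.mem_iUnion, Set.mem_ofPred_eq]
  refine ⟨b, hb, ?_⟩
  rwa [← mul_assoc, hxy, mul_inv_cancel_right]

/-- A ball of the Cayley graph of a finite set is finite, so a neighbourhood of `Y` is contained
in the product of `Y` with a finite set that does not depend on `Y`. -/
theorem exists_finite_cayleyNeighborhood_subset_mul (A : Finset G) (D : ℕ) :
    ∃ B : Set G, B.Finite ∧ ∀ Y : Set G, cayleyNeighborhood (A : Set G) D Y ⊆ Y * B := by
  set E : Set G := (A : Set G) ∪ (A : Set G)⁻¹ ∪ {1}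
  have hE : E.Finite := (A.finite_toSet.union A.finite_toSet.inv).union (Set.finite_singleton 1)
  have h1 : (1 : G) ∈ E := by simp [E]
  have key : ∀ {g y : G} (p : (SimpleGraph.mulCayley (A : Set G)).Walk g y),
      ∃ b ∈ E ^ p.length, g = y * b := by
    intro g y p
    induction p with
    | nil => exact ⟨1, by simp, by simp⟩
    | @cons u w z h p ih =>
      obtain ⟨b, hb, rfl⟩ := ih
      obtain ⟨-, a, ha, h⟩ := (SimpleGraph.mulCayley_adj' _ _ _).1 h
      rcases h with h | h
      · refine ⟨b * a⁻¹, ?_, ?_⟩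
        · rw [SimpleGraph.Walk.length_cons, pow_succ]
          exact Set.mul_mem_mul hb (by simp [E, ha])
        · rw [← mul_assoc, ← h]; simp
      · refine ⟨b * a, ?_, ?_⟩
        · rw [SimpleGraph.Walk.length_cons, pow_succ]
          exact Set.mul_mem_mul hb (by simp [E, ha])
        · rw [h, mul_assoc]
  have hpow : ∀ n : ℕ, (E ^ n).Finite := by
    intro n
    induction n with
    | zero => simp
    | succ n ih => rw [pow_succ]; exact ih.mul hE
  refine ⟨E ^ D, hpow D, ?_⟩
  rintro Y g ⟨y, hy, hgy⟩
  obtain ⟨p, hp⟩ := SimpleGraph.exists_walk_of_edist_ne_top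
    (ne_top_of_le_ne_top (ENat.natCast_ne_top D) hgy)
  rw [← hp] at hgy
  obtain ⟨b, hb, rfl⟩ := key p
  exact Set.mul_mem_mul hy (Set.pow_subset_pow_right h1 (by exact_mod_cast hgy) hb)

end HFinite

/-! ### Branches of the tree at a vertex -/

namespace GraphOfGroupsDecomposition

variable {G : Type*} [Group G] {T : Type*} [MulAction G T] (Γ : GraphOfGroupsDecomposition G T)

/-- The action of a group element on the tree. -/
def smulHom (g : G) : Γ.tree →g Γ.tree := ⟨fun x => g • x, fun h => Γ.smul_adj g h⟩

@[simp] theorem smul_dart_fst (g : G) (s : Γ.tree.Dart) : (g • s).fst = g • s.fst := rfl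

@[simp] theorem smul_dart_snd (g : G) (s : Γ.tree.Dart) : (g • s).snd = g • s.snd := rfl

theorem mem_terminalSide_iff_exists_walk {s : Γ.tree.Dart} {x : T} :
    x ∈ Γ.terminalSide s ↔ ∃ p : Γ.tree.Walk s.snd x, s.edge ∉ p.edges :=
  SimpleGraph.reachable_deleteEdges_iff_exists_walk

theorem snd_mem_terminalSide (s : Γ.tree.Dart) : s.snd ∈ Γ.terminalSide s :=
  SimpleGraph.Reachable.refl _

theorem smul_mem_terminalSide_of_mem (g : G) {s : Γ.tree.Dart} {x : T}
    (h : x ∈ Γ.terminalSide s) : g • x ∈ Γ.terminalSide (g • s) := by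
  obtain ⟨p, hp⟩ := Γ.mem_terminalSide_iff_exists_walk.1 h
  refine Γ.mem_terminalSide_iff_exists_walk.2 ⟨p.map (Γ.smulHom g), ?_⟩
  intro hmem
  obtain ⟨e, he, hes⟩ := List.mem_map.1 ((SimpleGraph.Walk.edges_map (Γ.smulHom g) p) ▸ hmem)
  have : Sym2.map (Γ.smulHom g) e = Sym2.map (Γ.smulHom g) s.edge := hes
  rw [Sym2.map.injective (MulAction.injective g) this] at he
  exact hp he

theorem smul_mem_terminalSide_iff (g : G) {s : Γ.tree.Dart} {x : T} :
    g • x ∈ Γ.terminalSide (g • s) ↔ x ∈ Γ.terminalSide s :=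
  ⟨fun h => by simpa using Γ.smul_mem_terminalSide_of_mem g⁻¹ h,
    Γ.smul_mem_terminalSide_of_mem g⟩

theorem mem_terminalSide_iff_of_adj {s : Γ.tree.Dart} {x y : T} (h : Γ.tree.Adj x y)
    (hs : s.edge ≠ s(x, y)) : x ∈ Γ.terminalSide s ↔ y ∈ Γ.terminalSide s := by
  have : (Γ.tree.deleteEdges {s.edge}).Adj x y :=
    SimpleGraph.deleteEdges_adj.2 ⟨h, fun h' => hs h'.symm⟩
  exact ⟨fun hx => SimpleGraph.Reachable.trans hx this.reachable,
    fun hx => SimpleGraph.Reachable.trans hx this.symm.reachable⟩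

theorem notMem_terminalSide_iff_of_isPath {s : Γ.tree.Dart} {u x : T} (h : Γ.tree.Adj s.snd u)
    (p : Γ.tree.Walk u x) (hp : (SimpleGraph.Walk.cons h p).IsPath) :
    x ∉ Γ.terminalSide s ↔ s.fst = u := by
  have hv := ((SimpleGraph.Walk.cons_isPath_iff h p).1 hp).2
  have hsp : s.edge ∉ p.edges := fun hs => hv (p.snd_mem_support_of_mem_edges hs)
  have hedge : s.edge = s(s.fst, s.snd) := rfl
  constructor
  · intro hx
    by_contra hne
    refine hx (Γ.mem_terminalSide_iff_exists_walk.2 ⟨SimpleGraph.Walk.cons h p, ?_⟩)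
    rw [SimpleGraph.Walk.edges_cons, List.mem_cons, not_or]
    refine ⟨fun he => ?_, hsp⟩
    rw [hedge, Sym2.eq_swap, Sym2.congr_right] at he
    exact hne he
  · rintro rfl hx
    classical
    obtain ⟨q, hq⟩ := Γ.mem_terminalSide_iff_exists_walk.1 hx
    -- A path avoiding `s` would differ from the given one, which begins with `s`.
    have huniq := (Γ.isTree.existsUnique_path s.snd x).unique hp q.bypass_isPath
    apply hq
    apply q.edges_bypass_subset_edges
    rw [← huniq, SimpleGraph.Walk.edges_cons, hedge, Sym2.eq_swap]
    exact List.mem_cons_self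

/-- The branches at `v` partition the vertices other than `v`. -/
theorem exists_unique_branch {v x : T} (hx : x ≠ v) :
    ∃! s : Γ.tree.Dart, s.snd = v ∧ x ∉ Γ.terminalSide s := by
  obtain ⟨p, hp, -⟩ := Γ.isTree.existsUnique_path v x
  cases p with
  | nil => exact absurd rfl hx
  | @cons _ u _ h p =>
    refine ⟨⟨(u, v), h.symm⟩, ⟨rfl, ?_⟩, ?_⟩
    · exact (Γ.notMem_terminalSide_iff_of_isPath (s := ⟨(u, v), h.symm⟩) h p hp).2 rfl
    · rintro s ⟨rfl, hs⟩
      have := (Γ.notMem_terminalSide_iff_of_isPath h p hp).1 hs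
      exact SimpleGraph.Dart.ext _ _ (Prod.ext this rfl)

/-- The endpoints of a walk avoiding `v` lie in the same branch at `v`. -/
theorem mem_terminalSide_iff_of_walk {s : Γ.tree.Dart} {x y : T} (p : Γ.tree.Walk x y)
    (h : s.snd ∉ p.support) : x ∈ Γ.terminalSide s ↔ y ∈ Γ.terminalSide s := by
  induction p with
  | nil => rfl
  | @cons a b _ hab p ih =>
    rw [SimpleGraph.Walk.support_cons, List.mem_cons, not_or] at h
    refine (Γ.mem_terminalSide_iff_of_adj hab ?_).trans (ih h.2)
    intro he
    have : s.snd ∈ s(a, b) := he ▸ Sym2.mem_mk_right s.fst s.snd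
    rcases Sym2.mem_iff.1 this with h' | h'
    · exact h.1 h'
    · exact h.2 (h' ▸ p.start_mem_support)

theorem hFinite_smul_eq (e s : Γ.tree.Dart) : HFinite (Γ.edgeGroup s) {g : G | g • e = s} := by
  by_cases h : ∃ a : G, a • e = s
  · obtain ⟨a, rfl⟩ := h
    refine hFinite_of_subset_coset a fun g hg => ?_
    change (g * a⁻¹) • a • e = a • e
    rw [smul_smul, inv_mul_cancel_right]
    exact hg
  · refine hFinite_empty.mono ?_
    exact fun g hg => h ⟨g, hg⟩

/-- The sets `Z_s` for two base vertices `x` and `y` are almost equal over the stabiliser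
of `s`. -/
theorem hFinite_separated (s : Γ.tree.Dart) (x y : T) :
    HFinite (Γ.edgeGroup s) {g : G | ¬ (g ∈ Γ.edgeSet x s ↔ g ∈ Γ.edgeSet y s)} := by
  obtain ⟨p⟩ := Γ.isTree.connected.preconnected x y
  induction p with
  | nil => exact hFinite_empty.mono fun g hg => hg Iff.rfl
  | @cons a b z hab p ih =>
    let e : Γ.tree.Dart := ⟨(a, b), hab⟩
    refine ((ih.union (Γ.hFinite_smul_eq e s)).union (Γ.hFinite_smul_eq e.symm s)).mono ?_
    intro g hg
    by_contra hcon
    simp only [Set.mem_union, Set.mem_ofPred_eq, not_or, not_not] at hcon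
    obtain ⟨⟨hz, he⟩, he'⟩ := hcon
    refine hg (Iff.trans ?_ hz)
    refine Γ.mem_terminalSide_iff_of_adj (Γ.smul_adj g hab) fun hs => ?_
    have hedge : s.edge = s(s.fst, s.snd) := rfl
    rw [hedge, Sym2.eq_iff] at hs
    rcases hs with ⟨h1, h2⟩ | ⟨h1, h2⟩
    · exact he (SimpleGraph.Dart.ext _ _ (Prod.ext h1.symm h2.symm))
    · exact he' (SimpleGraph.Dart.ext _ _ (Prod.ext h1.symm h2.symm))

/-! ### Extending a subset of a vertex group over the branches -/

/-- The extension of a subset `Y` of the vertex group `K` by a family `F` of edges into `v`: it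
contains all elements moving `v` into the branch of an edge in `F`. -/
def extension (v : T) {K : Subgroup G} (Y : Set K) (F : Set Γ.tree.Dart) : Set G :=
  Subtype.val '' Y ∪ {g | ∃ s ∈ F, s.snd = v ∧ g • v ∉ Γ.terminalSide s}

variable {Γ} {v : T} {H K : Subgroup G} {Y : Set K} {F : Set Γ.tree.Dart}

theorem coe_mem_extension_iff (hv : MulAction.stabilizer G v = K) (k : K) :
    (k : G) ∈ Γ.extension v Y F ↔ k ∈ Y := by
  have hk : (k : G) • v = v := by
    have : (k : G) ∈ MulAction.stabilizer G v := hv ▸ k.2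
    exact this
  constructor
  · rintro (⟨k', hk', h⟩ | ⟨s, -, rfl, hs⟩)
    · exact Subtype.val_injective h ▸ hk'
    · rw [hk] at hs
      exact absurd (Γ.snd_mem_terminalSide s) hs
  · exact fun h => Or.inl ⟨k, h, rfl⟩

theorem mem_extension_iff_of_smul_ne (hv : MulAction.stabilizer G v = K) {g : G}
    (hg : g • v ≠ v) :
    g ∈ Γ.extension v Y F ↔ ∃ s ∈ F, s.snd = v ∧ g • v ∉ Γ.terminalSide s := by
  refine or_iff_right ?_
  rintro ⟨k, -, rfl⟩
  have : (k : G) ∈ MulAction.stabilizer G v := hv ▸ k.2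
  exact hg this

theorem mem_extension_iff_mem (hv : MulAction.stabilizer G v = K) {g : G} {s : Γ.tree.Dart}
    (hs : s.snd = v) (hg : g • v ∉ Γ.terminalSide s) : g ∈ Γ.extension v Y F ↔ s ∈ F := by
  have hne : g • v ≠ v := fun h => hg (by rw [h, ← hs]; exact Γ.snd_mem_terminalSide s)
  rw [mem_extension_iff_of_smul_ne hv hne]
  constructor
  · rintro ⟨t, ht, htv⟩
    exact (Γ.exists_unique_branch hne).unique htv ⟨hs, hg⟩ ▸ ht
  · exact fun h => ⟨s, h, hs, hg⟩

theorem extension_inter_eq (hv : MulAction.stabilizer G v = K) :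
    Γ.extension v Y F ∩ (K : Set G) = Subtype.val '' Y := by
  ext g
  constructor
  · rintro ⟨hg, hK⟩
    exact ⟨⟨g, hK⟩, (coe_mem_extension_iff hv ⟨g, hK⟩).1 hg, rfl⟩
  · rintro ⟨k, hk, rfl⟩
    exact ⟨(coe_mem_extension_iff hv k).2 hk, k.2⟩

theorem encloses_extension (hv : MulAction.stabilizer G v = K) :
    Γ.Encloses v H (Γ.extension v Y F) := by
  intro w s hs
  -- The base vertex `v` gives an empty corner, so the corner for `w` is contained in the set of
  -- elements on which the two base vertices disagree.
  have hsep := Γ.hFinite_separated s w v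
  by_cases hF : s ∈ F
  · left; right
    refine hsep.mono ?_
    rintro g ⟨hg, hgX⟩ hiff
    exact hgX ((mem_extension_iff_mem hv hs fun h => hg (hiff.2 h)).2 hF)
  · right; right
    refine hsep.mono ?_
    rintro g ⟨hg, hgX⟩ hiff
    exact hF ((mem_extension_iff_mem hv hs fun h => hg (hiff.2 h)).1 hgX)

theorem mul_mem_extension (hv : MulAction.stabilizer G v = K) (hHK : H ≤ K)
    (hY : ∀ h ∈ H.subgroupOf K, ∀ y ∈ Y, h * y ∈ Y)
    (hF : ∀ h ∈ H, ∀ s ∈ F, h • s ∈ F) :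
    ∀ h ∈ H, ∀ x ∈ Γ.extension v Y F, h * x ∈ Γ.extension v Y F := by
  rintro h hh x (⟨k, hk, rfl⟩ | ⟨s, hs, hsv, hx⟩)
  · exact Or.inl ⟨⟨h, hHK hh⟩ * k, hY ⟨h, hHK hh⟩ (Subgroup.mem_subgroupOf.2 hh) k hk, rfl⟩
  · have hhv : h ∈ MulAction.stabilizer G v := hv ▸ hHK hh
    refine Or.inr ⟨h • s, hF h hh s hs, ?_, ?_⟩
    · rw [smul_dart_snd, hsv]; exact hhv
    · rwa [mul_smul, smul_mem_terminalSide_iff]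

/-- If, along `K`-orbits of edges into `v`, membership in `F` agrees with membership in `Y` up to
`H`-finite sets, then so does membership in the extension along the coset `K g` of any element `g`. -/
theorem hFinite_mul_mem_extension (hv : MulAction.stabilizer G v = K)
    (hY : IsAlmostInvariant (H.subgroupOf K) Y)
    (hF : ∀ s : Γ.tree.Dart, s.snd = v →
      HFinite (H.subgroupOf K) {k : K | ¬ ((k : G) • s ∈ F ↔ k ∈ Y)}) (g : G) :
    HFinite (H.subgroupOf K) {k : K | ¬ ((k : G) * g ∈ Γ.extension v Y F ↔ k ∈ Y)} := by
  by_cases hg : g • v = v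
  · have hgK : g ∈ K := hv ▸ hg
    refine (hY.hFinite_not_mul_mem_iff ⟨g, hgK⟩).mono ?_
    intro k hk
    rw [Set.mem_ofPred_eq, ← coe_mem_extension_iff (F := F) hv (k * ⟨g, hgK⟩)]
    exact hk
  · obtain ⟨s, ⟨hs, hgs⟩, -⟩ := Γ.exists_unique_branch hg
    refine (hF s hs).mono ?_
    intro k hk
    have hkv : (k : G) ∈ MulAction.stabilizer G v := hv ▸ k.2
    have : (k : G) * g ∈ Γ.extension v Y F ↔ (k : G) • s ∈ F := by
      refine mem_extension_iff_mem hv ?_ ?_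
      · rw [smul_dart_snd, hs]; exact hkv
      · rwa [mul_smul, smul_mem_terminalSide_iff]
    rw [Set.mem_ofPred_eq, ← this]
    exact hk

theorem isAlmostInvariant_extension (hv : MulAction.stabilizer G v = K) (hHK : H ≤ K)
    (hY : IsAlmostInvariant (H.subgroupOf K) Y) (hFH : ∀ h ∈ H, ∀ s ∈ F, h • s ∈ F)
    (hF : ∀ s : Γ.tree.Dart, s.snd = v →
      HFinite (H.subgroupOf K) {k : K | ¬ ((k : G) • s ∈ F ↔ k ∈ Y)}) :
    IsAlmostInvariant H (Γ.extension v Y F) := by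
  refine isAlmostInvariant_of_hFinite (mul_mem_extension hv hHK hY.left_invariant hFH) fun g => ?_
  set X := Γ.extension v Y F
  obtain ⟨p⟩ := Γ.isTree.connected.preconnected v (g • v)
  have hcoset : ∀ u : T, HFinite H {x : G | x • u = v ∧ ¬ (x * g ∈ X ↔ x ∈ X)} := by
    intro u
    by_cases hu : ∃ a : G, a • u = v
    · obtain ⟨a, ha⟩ := hu
      have h₁ := hFinite_mul_mem_extension hv hY hF a
      have h₂ := hFinite_mul_mem_extension hv hY hF (a * g)
      refine ((h₁.union h₂).image_val.image_mul_right a).mono ?_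
      rintro x ⟨hxu, hx⟩
      have hk : x * a⁻¹ ∈ K := by
        rw [← hv, MulAction.mem_stabilizer_iff, mul_smul, ← ha, inv_smul_smul, hxu, ha]
      refine ⟨x * a⁻¹, ⟨⟨x * a⁻¹, hk⟩, ?_, rfl⟩, by simp⟩
      by_contra hcon
      simp only [Set.mem_union, Set.mem_ofPred_eq, not_or, not_not, inv_mul_cancel_right,
        ← mul_assoc] at hcon
      exact hx (hcon.2.trans hcon.1.symm)
    · exact hFinite_empty.mono fun x hx => hu ⟨x, hx.1⟩
  refine (HFinite.biUnion (List.finite_toSet p.support) fun u _ => hcoset u).mono ?_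
  intro x hx
  simp only [Set.mem_iUnion, Set.mem_ofPred_eq]
  by_contra hcon
  -- The translated walk from `x • v` to `(x * g) • v` avoids `v`.
  let q : Γ.tree.Walk (x • v) (x • g • v) := p.map (Γ.smulHom x)
  have hq : v ∉ q.support := by
    intro hmem
    obtain ⟨u, hu, hxu⟩ := List.mem_map.1 ((SimpleGraph.Walk.support_map _ p) ▸ hmem)
    exact hcon ⟨u, hu, hxu, hx⟩
  have h₁ : x • v ≠ v := ne_of_mem_of_not_mem q.start_mem_support hq
  have h₂ : (x * g) • v ≠ v := by
    rw [mul_smul]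
    exact ne_of_mem_of_not_mem q.end_mem_support hq
  refine hx ?_
  rw [mem_extension_iff_of_smul_ne hv h₁, mem_extension_iff_of_smul_ne hv h₂]
  refine exists_congr fun s => and_congr_right fun _ => and_congr_right fun hs => not_congr ?_
  rw [mul_smul]
  exact (Γ.mem_terminalSide_iff_of_walk q (hs ▸ hq)).symm

/-! ### Choosing the branches of an adapted set -/

/-- Every edge into `v` is the translate of a chosen lift by an element of the stabiliser
of `v`. -/
theorem IsIncidentLift.exists_smul_eq {c : Γ.IncidentEdge (Γ.projVertex v) → Γ.tree.Dart}
    (hc : Γ.IsIncidentLift v c) (hv : MulAction.stabilizer G v = K) {s : Γ.tree.Dart}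
    (hs : s.snd = v) : ∃ (ε : _) (k : K), (k : G) • c ε = s := by
  have hε : Γ.terminal (Γ.projEdge s) = Γ.projVertex v := by
    rw [← hs]; rfl
  obtain ⟨g, hg⟩ : ∃ g : G, g • c ⟨Γ.projEdge s, hε⟩ = s :=
    Quotient.exact (s := MulAction.orbitRel G Γ.tree.Dart) (hc.projEdge_eq ⟨_, hε⟩).symm
  refine ⟨_, ⟨g, ?_⟩, hg⟩
  rw [← hv, MulAction.mem_stabilizer_iff]
  have := congrArg (fun t : Γ.tree.Dart => t.snd) hg
  simpa [hc.snd_eq, hs] using this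

theorem IsIncidentLift.eq_of_smul_eq {c : Γ.IncidentEdge (Γ.projVertex v) → Γ.tree.Dart}
    (hc : Γ.IsIncidentLift v c) {ε δ : Γ.IncidentEdge (Γ.projVertex v)} {g h : G}
    (hgh : g • c ε = h • c δ) : ε = δ := by
  apply Subtype.ext
  rw [← hc.projEdge_eq, ← hc.projEdge_eq]
  refine Quotient.sound (s := MulAction.orbitRel G Γ.tree.Dart) ⟨g⁻¹ * h, ?_⟩
  change (g⁻¹ * h) • c δ = c ε
  rw [mul_smul, ← hgh, inv_smul_smul]

/-- The edges `s` into `v` whose coset, consisting of the `k ∈ K` that carry a chosen lift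
to `s`, lies in `Y * B`. -/
def coveredEdges (c : Γ.IncidentEdge (Γ.projVertex v) → Γ.tree.Dart) (Y B : Set K) :
    Set Γ.tree.Dart :=
  {s | ∀ (ε : _) (k : K), (k : G) • c ε = s → k ∈ Y * B}

theorem smul_mem_coveredEdges {c : Γ.IncidentEdge (Γ.projVertex v) → Γ.tree.Dart} {B : Set K}
    (hHK : H ≤ K) (hY : ∀ h ∈ H.subgroupOf K, ∀ y ∈ Y, h * y ∈ Y) :
    ∀ h ∈ H, ∀ s ∈ coveredEdges c Y B, h • s ∈ coveredEdges c Y B := by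
  intro h hh s hs ε k hk
  obtain ⟨y, hy, b, hb, hyb⟩ := hs ε (⟨h, hHK hh⟩⁻¹ * k) (by
    change (h⁻¹ * (k : G)) • c ε = s
    rw [mul_smul, hk, inv_smul_smul])
  refine ⟨⟨h, hHK hh⟩ * y, hY _ (Subgroup.mem_subgroupOf.2 hh) y hy, b, hb, ?_⟩
  have hyb' : y * b = (⟨h, hHK hh⟩ : K)⁻¹ * k := hyb
  change _ * y * b = k
  rw [mul_assoc, hyb', mul_inv_cancel_left]

theorem hFinite_smul_mem_coveredEdges {c : Γ.IncidentEdge (Γ.projVertex v) → Γ.tree.Dart}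
    (hc : Γ.IsIncidentLift v c) (hv : MulAction.stabilizer G v = K)
    (hY : IsAlmostInvariant (H.subgroupOf K) Y) {B : Set K} (hB : B.Finite)
    (hYB : ∀ (ε : _) (k : K), k • (Γ.incidentEdgeGroups K c ε : Set K) ⊆ Y * B ∨
      k • (Γ.incidentEdgeGroups K c ε : Set K) ⊆ Yᶜ * B)
    {s : Γ.tree.Dart} (hs : s.snd = v) :
    HFinite (H.subgroupOf K) {k : K | ¬ ((k : G) • s ∈ coveredEdges c Y B ↔ k ∈ Y)} := by
  obtain ⟨ε, a, rfl⟩ := hc.exists_smul_eq hv hs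
  refine (hY.hFinite_exists_mul hB a).mono ?_
  intro k hk
  have hka : ((k * a : K) : G) • c ε = (k : G) • (a : G) • c ε := by
    rw [Subgroup.coe_mul, mul_smul]
  by_cases hmem : (k : G) • (a : G) • c ε ∈ coveredEdges c Y B
  · obtain ⟨y, hy, b, hb, hyb⟩ := hmem ε (k * a) hka
    have hkY : k ∉ Y := fun h => hk (iff_of_true hmem h)
    exact ⟨b, hb, y, hyb.symm, fun h => hkY (h.1 hy)⟩
  · have hkY : k ∈ Y := by
      by_contra h
      exact hk (iff_of_false hmem h)
    have hnot : ¬ ∀ (δ : _) (k' : K), (k' : G) • c δ = (k : G) • (a : G) • c ε → k' ∈ Y * B :=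
      hmem
    push Not at hnot
    obtain ⟨δ, k', hk', hk'Y⟩ := hnot
    obtain rfl := hc.eq_of_smul_eq (hk'.trans hka.symm)
    have hself : k' ∈ k' • (Γ.incidentEdgeGroups K c δ : Set K) :=
      ⟨1, Subgroup.one_mem _, by simp⟩
    have hkmem : k * a ∈ k' • (Γ.incidentEdgeGroups K c δ : Set K) := by
      rw [Set.mem_smul_set_iff_inv_smul_mem]
      change (k' : G)⁻¹ * ((k * a : K) : G) ∈ MulAction.stabilizer G (c δ)
      rw [MulAction.mem_stabilizer_iff, mul_smul, hka, ← hk', inv_smul_smul]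
    rcases hYB δ k' with h | h
    · exact absurd (h hself) hk'Y
    · obtain ⟨y, hy, b, hb, hyb⟩ := h hkmem
      exact ⟨b, hb, y, hyb.symm, fun h => hy (h.2 hkY)⟩

end GraphOfGroupsDecomposition

end AlmostInvariant

theorem mainTheorem7 {G : Type*} [Group G] [Group.FG G] {T : Type*} [MulAction G T]
    (Γ : AlmostInvariant.GraphOfGroupsDecomposition G T) (hΓ : Γ.IsMinimal)
    (H K : Subgroup G) (hH : H.FG) (hK : K.FG) (hHK : H ≤ K)
    (v : T) (hv : MulAction.stabilizer G v = K)
    (c : Γ.IncidentEdge (Γ.projVertex v) → Γ.tree.Dart) (hc : Γ.IsIncidentLift v c)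
    (Y : Set K)
    (hY : AlmostInvariant.IsAlmostInvariant (H.subgroupOf K) Y)
    (hYn : AlmostInvariant.IsNontrivial (H.subgroupOf K) Y)
    (hYa : AlmostInvariant.IsAdapted (Γ.incidentEdgeGroups K c) Y) :
    ∃ X : Set G, AlmostInvariant.IsAlmostInvariant H X ∧ Γ.Encloses v H X ∧
      X ∩ (K : Set G) = Subtype.val '' Y := by
  obtain ⟨A, -, D, hAD⟩ := hYa
  obtain ⟨B, hB, hnbhd⟩ := AlmostInvariant.exists_finite_cayleyNeighborhood_subset_mul A D
  have hYB := fun ε k => (hAD ε k).imp (fun h => h.trans (hnbhd Y)) (fun h => h.trans (hnbhd Yᶜ))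
  open AlmostInvariant.GraphOfGroupsDecomposition in
  exact ⟨Γ.extension v Y (coveredEdges c Y B),
    isAlmostInvariant_extension hv hHK hY (smul_mem_coveredEdges hHK hY.left_invariant)
      fun s hs => hFinite_smul_mem_coveredEdges hc hv hY hB hYB hs,
    encloses_extension hv, extension_inter_eq hv⟩
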